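/- Let $d\ge 1$ and $c_a,c_b>0$. There is a constant $C>0$, depending only on $d$, $c_a$ and $c_b$, with the following property. Let $\Omega\subset\mathbb{R}^d$ be a bounded polyhedral domain (a nonempty, bounded, connected open set whose boundary lies in a finite union of hyperplanes) and let $\Gamma_D\subseteq\partial\Omega$ (the pure Dirichlet problem is the case $\Gamma_D=\partial\Omega$). Let $a,b:\Omega\to\mathbb{R}^{d\times d}$ be diffusion coefficients with integrable entries such that, for almost every $x\in\Omega$ and all $\xi\in\mathbb{R}^d$, $$\xi^Ta(x)\xi\ge c_a|\xi|^2,\qquad \xi^Tb(x)\xi\ge c_b|\xi|^2 .$$ Let $\mathcal{T}$ be a finite conforming simplicial triangulation of $\overline\Omega$ with mesh size $h=\max_{K\in\mathcal{T}}\operatorname{diam}K$. Let $z_1,\dots,z_{N_h}$ be the vertices of $\mathcal{T}$ that do not lie on $\Gamma_D$, and let $\phi_1,\dots,\phi_{N_h}$ be the corresponding continuous piecewise linear nodal basis functions: $\phi_i$ is linear on each $K\in\mathcal{T}$, equals $1$ at $z_i$ and $0$ at every other vertex. Define the mass and stiffness matrices $$M_{ij}=\int_\Omega\phi_i\phi_j,\qquad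 A_{ij}=\int_\Omega a\nabla\phi_i\cdot\nabla\phi_j,\qquad B_{ij}=\int_\Omega b\nabla\phi_i\cdot\nabla\phi_j .$$ Let $\bar M$ be the lumped mass matrix, in either of the following senses: the diagonal matrix of the row sums of $M$, $\bar M_{ii}=\sum_{j=1}^{N_h}M_{ij}$; or the vertex quadrature matrix, $\bar M_{ij}=\sum_{K\in\mathcal{T}}\frac{|K|}{d+1}\sum_{z\text{ vertex of }K}\phi_i(z)\phi_j(z)$. For $\tau\in\mathbb{R}$ put $$\mathcal{A}=\begin{pmatrix}\tau A&M\\M&-\tau B\end{pmatrix},\qquad \mathcal{B}=\begin{pmatrix}\tau A&\bar M\\\bar M&-\tau B\end{pmatrix}.$$ If $\tau\ge Ch^2$, then $\mathcal{B}$ is invertible, every eigenvalue $\lambda\in\mathbb{C}$ of $\mathcal{B}^{-1}\mathcal{A}$ satisfies $|\lambda-1|<1$, and the spectral radius satisfies $\rho(\mathcal{B}^{-1}\mathcal{A})<2$. -/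

import Mathlib

open MeasureTheory

namespace MixedFEM

/-- Euclidean space `ℝ^d`. -/
abbrev Pt (d : ℕ) : Type := EuclideanSpace ℝ (Fin d)

/-- A bounded polyhedral domain in `ℝ^d`: a nonempty bounded connected open set whose boundary lies
in a finite union of proper affine subspaces. -/
structure IsPolyhedralDomain {d : ℕ} (Ω : Set (Pt d)) : Prop where
  isOpen : IsOpen Ω
  isConnected : IsConnected Ω
  isBounded : Bornology.IsBounded Ω
  polyhedral : ∃ S : Set (AffineSubspace ℝ (Pt d)), S.Finite ∧ (∀ H ∈ S, H ≠ ⊤) ∧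
    frontier Ω ⊆ ⋃ H ∈ S, (H : Set (Pt d))

/-- A (conforming, simplicial) triangulation of `Ω ⊆ ℝ^d`: a finite geometric simplicial complex,
all of whose faces are faces of `d`-simplices of the complex, and which covers the closure
of `Ω`. -/
structure Triangulation {d : ℕ} (Ω : Set (Pt d)) extends
    Geometry.SimplicialComplex ℝ (Pt d) where
  finite_faces : faces.Finite
  pure : ∀ s ∈ faces, ∃ t ∈ faces, s ⊆ t ∧ t.card = d + 1
  space_eq : toSimplicialComplex.space = closure Ω

namespace Triangulation

variable {d : ℕ} {Ω : Set (Pt d)} (T : Triangulation Ω)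

/-- The elements `K` of the triangulation: its `d`-simplices, each given by its `d + 1`
vertices. -/
noncomputable def cells : Finset (Finset (Pt d)) :=
  T.finite_faces.toFinset.filter fun s => s.card = d + 1

theorem mem_cells {s : Finset (Pt d)} : s ∈ T.cells ↔ s ∈ T.faces ∧ s.card = d + 1 := by
  simp [cells]

/-- The mesh size `h`, the largest diameter of an element. -/
noncomputable def meshSize : ℝ :=
  ⨆ s : T.cells, Metric.diam (convexHull ℝ ((s : Finset (Pt d)) : Set (Pt d)))

/-- The vertices of an element, as an affine basis of `ℝ^d`; its coordinate functions are the
barycentric coordinates of the element. -/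
noncomputable def cellBasis (s : T.cells) : AffineBasis (s : Finset (Pt d)) ℝ (Pt d) where
  toFun := Subtype.val
  ind' := T.indep (T.mem_cells.1 s.2).1
  tot' := by
    rw [(T.indep (T.mem_cells.1 s.2).1).affineSpan_eq_top_iff_card_eq_finrank_add_one]
    simp [(T.mem_cells.1 s.2).2]

open Classical in
/-- The piecewise linear nodal basis function ("hat function") at the vertex `z`: on each element
with vertex `z` it is the barycentric coordinate belonging to `z`, and it vanishes elsewhere. -/
noncomputable def hat (z x : Pt d) : ℝ :=
  if h : ∃ s : T.cells, z ∈ (s : Finset (Pt d)) ∧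
      x ∈ convexHull ℝ ((s : Finset (Pt d)) : Set (Pt d))
  then (T.cellBasis h.choose).coord ⟨z, h.choose_spec.1⟩ x
  else 0

/-- Barycentric coordinates of two elements agree on their intersection, so that `hat` does not
depend on the choice of the element. -/
theorem hat_eq_coord (s : T.cells) {x z : Pt d} (hz : z ∈ (s : Finset (Pt d)))
    (hx : x ∈ convexHull ℝ ((s : Finset (Pt d)) : Set (Pt d))) :
    T.hat z x = (T.cellBasis s).coord ⟨z, hz⟩ x := by
  classical
  have h : ∃ s : T.cells, z ∈ (s : Finset (Pt d)) ∧
      x ∈ convexHull ℝ ((s : Finset (Pt d)) : Set (Pt d)) := ⟨s, hz, hx⟩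
  rw [hat, dif_pos h]
  generalize_proofs hzt
  have hxt := h.choose_spec.2
  generalize h.choose = t at hzt hxt ⊢
  have hmem := T.inter_subset_convexHull (T.mem_cells.1 t.2).1 (T.mem_cells.1 s.2).1 ⟨hxt, hx⟩
  suffices H : convexHull ℝ (((t : Finset (Pt d)) : Set (Pt d)) ∩ ((s : Finset (Pt d)) : Set (Pt d)))
      ⊆ {y | (T.cellBasis t).coord ⟨z, hzt⟩ y = (T.cellBasis s).coord ⟨z, hz⟩ y} from H hmem
  refine convexHull_min ?_ ?_
  · rintro y ⟨hyt, hys⟩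
    change (T.cellBasis t).coord ⟨z, hzt⟩ (T.cellBasis t ⟨y, hyt⟩) =
      (T.cellBasis s).coord ⟨z, hz⟩ (T.cellBasis s ⟨y, hys⟩)
    rw [AffineBasis.coord_apply, AffineBasis.coord_apply]
    simp
  · intro u hu v hv p q _ _ hpq
    change (T.cellBasis t).coord ⟨z, hzt⟩ u = (T.cellBasis s).coord ⟨z, hz⟩ u at hu
    change (T.cellBasis t).coord ⟨z, hzt⟩ v = (T.cellBasis s).coord ⟨z, hz⟩ v at hv
    change (T.cellBasis t).coord ⟨z, hzt⟩ (p • u + q • v) =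
      (T.cellBasis s).coord ⟨z, hz⟩ (p • u + q • v)
    rw [Convex.combo_affine_apply hpq, Convex.combo_affine_apply hpq, hu, hv]

/-- `hat z` vanishes on every element that does not have `z` as a vertex. -/
theorem hat_eq_zero (s : T.cells) {x z : Pt d} (hz : z ∉ (s : Finset (Pt d)))
    (hx : x ∈ convexHull ℝ ((s : Finset (Pt d)) : Set (Pt d))) : T.hat z x = 0 := by
  classical
  by_cases h : ∃ s : T.cells, z ∈ (s : Finset (Pt d)) ∧
      x ∈ convexHull ℝ ((s : Finset (Pt d)) : Set (Pt d))
  · obtain ⟨t, hzt, hxt⟩ := h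
    rw [T.hat_eq_coord t hzt hxt]
    have hmem := T.inter_subset_convexHull (T.mem_cells.1 t.2).1 (T.mem_cells.1 s.2).1 ⟨hxt, hx⟩
    suffices H : convexHull ℝ
        (((t : Finset (Pt d)) : Set (Pt d)) ∩ ((s : Finset (Pt d)) : Set (Pt d)))
        ⊆ {y | (T.cellBasis t).coord ⟨z, hzt⟩ y = 0} from H hmem
    refine convexHull_min ?_ ?_
    · rintro y ⟨hyt, hys⟩
      change (T.cellBasis t).coord ⟨z, hzt⟩ (T.cellBasis t ⟨y, hyt⟩) = 0
      rw [AffineBasis.coord_apply, if_neg]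
      rintro h
      exact hz (by rw [Subtype.mk.injEq] at h; exact h ▸ hys)
    · intro u hu v hv p q _ _ hpq
      change (T.cellBasis t).coord ⟨z, hzt⟩ u = 0 at hu
      change (T.cellBasis t).coord ⟨z, hzt⟩ v = 0 at hv
      change (T.cellBasis t).coord ⟨z, hzt⟩ (p • u + q • v) = 0
      rw [Convex.combo_affine_apply hpq, hu, hv]
      simp
  · rw [hat, dif_neg h]

/-- The degrees of freedom: the vertices of the triangulation that are not on the Dirichlet
boundary `Γ`. -/
def Node (Γ : Set (Pt d)) : Type := {z : Pt d // z ∈ T.vertices ∧ z ∉ Γ}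

noncomputable instance instDecidableEqNode (Γ : Set (Pt d)) : DecidableEq (T.Node Γ) :=
  Classical.decEq _

theorem finite_node (Γ : Set (Pt d)) : Finite (T.Node Γ) := by
  have h : {z : Pt d | z ∈ T.vertices ∧ z ∉ Γ}.Finite := by
    refine (T.finite_faces.preimage (f := fun z : Pt d => ({z} : Finset (Pt d))) ?_).subset ?_
    · exact fun a _ b _ hab => Finset.singleton_injective hab
    · exact fun z hz => hz.1
  exact h.to_subtype

noncomputable instance instFintypeNode (Γ : Set (Pt d)) : Fintype (T.Node Γ) :=
  haveI := T.finite_node Γ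
  Fintype.ofFinite _

variable (Γ : Set (Pt d))

/-- The nodal basis function `φ_i` belonging to a degree of freedom. If `Γ` is a union of faces of
the triangulation, these functions form the nodal basis of the space of all continuous piecewise
linear functions that vanish on `Γ`. -/
noncomputable def phi (i : T.Node Γ) : Pt d → ℝ := T.hat i.1

/-- The consistent mass matrix `M i j = (φ_i, φ_j)`. -/
noncomputable def massMatrix : Matrix (T.Node Γ) (T.Node Γ) ℝ :=
  Matrix.of fun i j => ∫ x in Ω, T.phi Γ i x * T.phi Γ j x

/-- The stiffness matrix `A i j = (a ∇φ_i, ∇φ_j)` with diffusion coefficient `a`. The gradients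
exist off the element boundaries, a null set. -/
noncomputable def stiffnessMatrix (a : Pt d → Matrix (Fin d) (Fin d) ℝ) :
    Matrix (T.Node Γ) (T.Node Γ) ℝ :=
  Matrix.of fun i j => ∫ x in Ω,
    (Matrix.mulVec (a x) (gradient (T.phi Γ i) x).ofLp) ⬝ᵥ (gradient (T.phi Γ j) x).ofLp

/-- The lumped mass matrix: the diagonal matrix of the row sums of the mass matrix. -/
noncomputable def rowSumMassMatrix : Matrix (T.Node Γ) (T.Node Γ) ℝ :=
  Matrix.diagonal fun i => ∑ j, T.massMatrix Γ i j

/-- The vertex quadrature formula `Q_K(f) = |K| / (d + 1) * ∑ f(z)`, over the vertices `z` of the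
simplex `K`. -/
noncomputable def vertexQuadrature (K : Finset (Pt d)) (f : Pt d → ℝ) : ℝ :=
  (volume (convexHull ℝ (K : Set (Pt d)))).toReal / (d + 1) * ∑ z ∈ K, f z

/-- The lumped mass matrix given by vertex quadrature, with entries
`(φ_i, φ_j)_h = ∑_K Q_K(φ_i φ_j)`. -/
noncomputable def quadratureMassMatrix : Matrix (T.Node Γ) (T.Node Γ) ℝ :=
  Matrix.of fun i j => ∑ K ∈ T.cells, vertexQuadrature K fun x => T.phi Γ i x * T.phi Γ j x

end Triangulation

/-- `a` is a matrix-valued diffusion coefficient on `Ω` with integrable entries, which is coercive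
with lower bound `c`. -/
structure IsDiffusionCoefficient {d : ℕ} (Ω : Set (Pt d))
    (a : Pt d → Matrix (Fin d) (Fin d) ℝ) (c : ℝ) : Prop where
  integrable : ∀ k l, IntegrableOn (fun x => a x k l) Ω
  coercive : ∀ᵐ x ∂(volume.restrict Ω), ∀ ξ : Fin d → ℝ,
    c * (ξ ⬝ᵥ ξ) ≤ ξ ⬝ᵥ (Matrix.mulVec (a x) ξ)

/-- The block matrix `[τ A, N; N, -τ B]`. -/
def blockMatrix {ι : Type*} (τ : ℝ) (A B N : Matrix ι ι ℝ) : Matrix (ι ⊕ ι) (ι ⊕ ι) ℝ :=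
  Matrix.fromBlocks (τ • A) N N (-(τ • B))

end MixedFEM

/-! An eigenvector `v` of `ℬ⁻¹𝒜` with eigenvalue `μ` satisfies `(𝒜 - ℬ) v = (μ - 1) ℬ v`. If `|μ -
1| ≥ 1`, this reads `ℬ v = s (𝒜 - ℬ) v` with `|s| ≤ 1`, while a kernel vector of `ℬ` is the case `s
= 0`. So both invertibility and the eigenvalue bound follow once this system has only the zero
solution (`IsLumpedPair.complex_system_eq_zero`).

The matrix `𝒜 - ℬ` has only the off-diagonal blocks `E = M - M̄`. Pair the first row with the first
component of `v`, the second row with minus the second component, and take real parts. The lumped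
mass and the part with `Re s` cancel by symmetry. What remains equates `τ` times the coercive `A`
and `B` terms with a multiple of `Im s` times the imaginary part of the `E` form.

On each element, lumping replaces a symmetric form by its row sums, so `2 uᵀEv` is minus a sum of
`m(z,w) (u z - u w) (v z - v w)`. Each difference is at most `h` times the gradient norm, and the
weights add up to at most the volume of the element. Hence `2 |uᵀEv| ≤ (h² / 2) (energy u + energy
v)` (`Triangulation.IsLumping.two_mul_abs_le`), and `τ min(ca, cb) ≥ h²` forces every component to
have zero energy.

Zero energy need not mean zero, since constants may be admissible. But then `A`, `B` and `E`
annihilate the components, the system collapses to `M̄ v = 0` in each block, and the positive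
diagonal of `M̄` gives `v = 0`. Symmetry of the diffusion coefficients plays no role. -/

namespace MixedFEM

/-! ### Linear algebra: the perturbed saddle point system and its spectrum. -/

section LinearAlgebra

open Matrix

variable {ι : Type*} [Fintype ι]

/-- The discrete data of a mixed problem: stiffness matrices `A`, `B` that are coercive with respect
to a discrete energy `q`, a mass matrix `M` and a lumped mass matrix `N` whose difference is bounded
by the energy. -/
structure IsLumpedPair (A B M N : Matrix ι ι ℝ) (q : (ι → ℝ) → ℝ) (α β κ : ℝ) : Prop where
  energy_nonneg : ∀ x, 0 ≤ q x
  isSymm_mass : M.IsSymm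
  isSymm_lumped : N.IsSymm
  coercive_left : ∀ x, α * q x ≤ x ⬝ᵥ A *ᵥ x
  coercive_right : ∀ x, β * q x ≤ x ⬝ᵥ B *ᵥ x
  mulVec_left : ∀ x, q x = 0 → A *ᵥ x = 0
  mulVec_right : ∀ x, q x = 0 → B *ᵥ x = 0
  lumping_error : ∀ x y, 2 * |x ⬝ᵥ (M - N) *ᵥ y| ≤ κ * (q x + q y)
  mulVec_error : ∀ x, q x = 0 → (M - N) *ᵥ x = 0
  lumped_injective : ∀ x, N *ᵥ x = 0 → x = 0

theorem dotProduct_mulVec_comm_of_isSymm {S : Matrix ι ι ℝ} (hS : S.IsSymm) (x y : ι → ℝ) :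
    x ⬝ᵥ S *ᵥ y = y ⬝ᵥ S *ᵥ x := by
  rw [dotProduct_mulVec, ← mulVec_transpose, hS.eq, dotProduct_comm]

namespace IsLumpedPair

variable {A B M N : Matrix ι ι ℝ} {q : (ι → ℝ) → ℝ} {α β κ τ : ℝ}

/-- The hypotheses are the real and imaginary parts of the two block rows of `ℬ v = s (𝒜 - ℬ) v`,
with `s = p + i r` and `v = (x + i y, x' + i y')`. Only `r` needs a bound, because the terms with
`p` cancel. -/
theorem real_system_eq_zero (H : IsLumpedPair A B M N q α β κ) (hτ : 0 < τ)
    (hα : κ < τ * α) (hβ : κ < τ * β) {p r : ℝ} (hr : |r| ≤ 1) {x y x' y' : ι → ℝ}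
    (h₁ : τ • A *ᵥ x + N *ᵥ x' = p • (M - N) *ᵥ x' - r • (M - N) *ᵥ y')
    (h₂ : τ • A *ᵥ y + N *ᵥ y' = p • (M - N) *ᵥ y' + r • (M - N) *ᵥ x')
    (h₃ : N *ᵥ x - τ • B *ᵥ x' = p • (M - N) *ᵥ x - r • (M - N) *ᵥ y)
    (h₄ : N *ᵥ y - τ • B *ᵥ y' = p • (M - N) *ᵥ y + r • (M - N) *ᵥ x) :
    x = 0 ∧ y = 0 ∧ x' = 0 ∧ y' = 0 := by
  have hE : (M - N).IsSymm := H.isSymm_mass.sub H.isSymm_lumped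
  -- Testing the second row with the opposite sign makes the `B` terms positive and cancels the `N`
  -- terms.
  have key : τ * (x ⬝ᵥ A *ᵥ x + y ⬝ᵥ A *ᵥ y + x' ⬝ᵥ B *ᵥ x' + y' ⬝ᵥ B *ᵥ y') =
      2 * (r * (y ⬝ᵥ (M - N) *ᵥ x' - x ⬝ᵥ (M - N) *ᵥ y')) := by
    have e₁ := congrArg (x ⬝ᵥ ·) h₁
    have e₂ := congrArg (y ⬝ᵥ ·) h₂
    have e₃ := congrArg (x' ⬝ᵥ ·) h₃
    have e₄ := congrArg (y' ⬝ᵥ ·) h₄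
    simp only [dotProduct_add, dotProduct_sub, dotProduct_smul, smul_eq_mul] at e₁ e₂ e₃ e₄
    rw [dotProduct_mulVec_comm_of_isSymm H.isSymm_lumped x' x,
      dotProduct_mulVec_comm_of_isSymm hE x' x, dotProduct_mulVec_comm_of_isSymm hE x' y] at e₃
    rw [dotProduct_mulVec_comm_of_isSymm H.isSymm_lumped y' y,
      dotProduct_mulVec_comm_of_isSymm hE y' y, dotProduct_mulVec_comm_of_isSymm hE y' x] at e₄
    linear_combination e₁ + e₂ - e₃ - e₄
  have hR : 2 * (r * (y ⬝ᵥ (M - N) *ᵥ x' - x ⬝ᵥ (M - N) *ᵥ y')) ≤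
      κ * (q x + q y + q x' + q y') := by
    have a₁ := H.lumping_error y x'
    have a₂ := H.lumping_error x y'
    have a₃ : r * (y ⬝ᵥ (M - N) *ᵥ x' - x ⬝ᵥ (M - N) *ᵥ y') ≤
        1 * (|y ⬝ᵥ (M - N) *ᵥ x'| + |x ⬝ᵥ (M - N) *ᵥ y'|) := by
      refine (le_abs_self _).trans ?_
      rw [abs_mul]
      exact mul_le_mul hr (abs_sub _ _) (abs_nonneg _) zero_le_one
    linarith
  have hL : τ * α * (q x + q y) + τ * β * (q x' + q y') ≤
      τ * (x ⬝ᵥ A *ᵥ x + y ⬝ᵥ A *ᵥ y + x' ⬝ᵥ B *ᵥ x' + y' ⬝ᵥ B *ᵥ y') := by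
    have := mul_le_mul_of_nonneg_left (add_le_add (add_le_add (H.coercive_left x)
      (H.coercive_left y)) (add_le_add (H.coercive_right x') (H.coercive_right y'))) hτ.le
    linarith
  have hx := H.energy_nonneg x
  have hy := H.energy_nonneg y
  have hx' := H.energy_nonneg x'
  have hy' := H.energy_nonneg y'
  have hsum : (τ * α - κ) * (q x + q y) + (τ * β - κ) * (q x' + q y') ≤ 0 := by linarith
  have b₁ : 0 ≤ (τ * α - κ) * (q x + q y) := mul_nonneg (by linarith) (by linarith)
  have b₂ : 0 ≤ (τ * β - κ) * (q x' + q y') := mul_nonneg (by linarith) (by linarith)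
  have c₁ : q x + q y = 0 :=
    (mul_eq_zero.1 (le_antisymm (by linarith) b₁)).resolve_left (by linarith)
  have c₂ : q x' + q y' = 0 :=
    (mul_eq_zero.1 (le_antisymm (by linarith) b₂)).resolve_left (by linarith)
  have zx : q x = 0 := by linarith
  have zy : q y = 0 := by linarith
  have zx' : q x' = 0 := by linarith
  have zy' : q y' = 0 := by linarith
  -- With zero energies every term but the lumped mass drops out of the four equations.
  simp only [H.mulVec_left x zx, H.mulVec_left y zy, H.mulVec_right x' zx', H.mulVec_right y' zy',
    H.mulVec_error x zx, H.mulVec_error y zy, H.mulVec_error x' zx', H.mulVec_error y' zy',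
    smul_zero, add_zero, sub_zero, zero_add] at h₁ h₂ h₃ h₄
  exact ⟨H.lumped_injective x h₃, H.lumped_injective y h₄, H.lumped_injective x' h₁,
    H.lumped_injective y' h₂⟩

theorem re_map_ofReal_mulVec {m n : Type*} [Fintype n] (S : Matrix m n ℝ) (v : n → ℂ) (i : m) :
    ((S.map (algebraMap ℝ ℂ) *ᵥ v) i).re = (S *ᵥ fun j => (v j).re) i := by
  simp [mulVec, dotProduct]

theorem im_map_ofReal_mulVec {m n : Type*} [Fintype n] (S : Matrix m n ℝ) (v : n → ℂ) (i : m) :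
    ((S.map (algebraMap ℝ ℂ) *ᵥ v) i).im = (S *ᵥ fun j => (v j).im) i := by
  simp [mulVec, dotProduct]

theorem blockMatrix_sub_blockMatrix {n : Type*} (τ : ℝ) (A B M N : Matrix n n ℝ) :
    blockMatrix τ A B M - blockMatrix τ A B N = fromBlocks 0 (M - N) (M - N) 0 := by
  rw [blockMatrix, blockMatrix, sub_eq_add_neg, fromBlocks_neg, fromBlocks_add]
  simp [sub_eq_add_neg]

theorem complex_system_eq_zero (H : IsLumpedPair A B M N q α β κ) (hτ : 0 < τ)
    (hα : κ < τ * α) (hβ : κ < τ * β) {s : ℂ} (hs : ‖s‖ ≤ 1) {v : ι ⊕ ι → ℂ}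
    (hv : (blockMatrix τ A B N).map (algebraMap ℝ ℂ) *ᵥ v =
      s • ((blockMatrix τ A B M - blockMatrix τ A B N).map (algebraMap ℝ ℂ) *ᵥ v)) : v = 0 := by
  rw [blockMatrix_sub_blockMatrix] at hv
  have hre : ∀ i, _ := fun i => congrArg Complex.re (congrFun hv i)
  have him : ∀ i, _ := fun i => congrArg Complex.im (congrFun hv i)
  simp only [Pi.smul_apply, smul_eq_mul, Complex.mul_re, Complex.mul_im, re_map_ofReal_mulVec,
    im_map_ofReal_mulVec, blockMatrix, fromBlocks_mulVec] at hre him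
  obtain ⟨h₁, h₂, h₃, h₄⟩ := H.real_system_eq_zero hτ hα hβ (p := s.re) (r := s.im)
    (x := fun i => (v (Sum.inl i)).re) (y := fun i => (v (Sum.inl i)).im)
    (x' := fun i => (v (Sum.inr i)).re) (y' := fun i => (v (Sum.inr i)).im)
    ((Complex.abs_im_le_norm s).trans hs)
    (by ext i; simpa [smul_mulVec, Function.comp_def] using hre (Sum.inl i))
    (by ext i; simpa [smul_mulVec, Function.comp_def] using him (Sum.inl i))
    (by ext i; simpa [smul_mulVec, neg_mulVec, Function.comp_def, sub_eq_add_neg]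
          using hre (Sum.inr i))
    (by ext i; simpa [smul_mulVec, neg_mulVec, Function.comp_def, sub_eq_add_neg]
          using him (Sum.inr i))
  ext i
  rcases i with i | i
  · exact Complex.ext (congrFun h₁ i) (congrFun h₂ i)
  · exact Complex.ext (congrFun h₃ i) (congrFun h₄ i)

/-- A real kernel vector solves the complex system with `s = 0`. -/
theorem isUnit_det [DecidableEq ι] (H : IsLumpedPair A B M N q α β κ) (hτ : 0 < τ)
    (hα : κ < τ * α) (hβ : κ < τ * β) : IsUnit (blockMatrix τ A B N).det := by
  rw [isUnit_iff_ne_zero]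
  intro h0
  obtain ⟨v, hv0, hv⟩ := exists_mulVec_eq_zero_iff.2 h0
  refine hv0 ?_
  have hz := H.complex_system_eq_zero hτ hα hβ (s := 0) (v := fun i => (v i : ℂ)) (by simp) (by
    rw [zero_smul]
    ext i
    refine Complex.ext ?_ ?_
    · rw [re_map_ofReal_mulVec]
      simpa using congrFun hv i
    · rw [im_map_ofReal_mulVec]
      simp [mulVec, dotProduct])
  ext i
  simpa using congrFun hz i

theorem norm_sub_one_lt [DecidableEq ι] (H : IsLumpedPair A B M N q α β κ) (hτ : 0 < τ)
    (hα : κ < τ * α) (hβ : κ < τ * β) {μ : ℂ}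
    (hμ : μ ∈ spectrum ℂ (((blockMatrix τ A B N)⁻¹ * blockMatrix τ A B M).map (algebraMap ℝ ℂ))) :
    ‖μ - 1‖ < 1 := by
  have hdet := H.isUnit_det hτ hα hβ
  rw [← spectrum_toLin', ← Module.End.hasEigenvalue_iff_mem_spectrum] at hμ
  obtain ⟨v, hv⟩ := hμ.exists_hasEigenvector
  have hv1 := hv.apply_eq_smul
  rw [toLin'_apply] at hv1
  by_contra! hlt
  have hne : μ - 1 ≠ 0 := by
    intro h
    rw [h, norm_zero] at hlt
    linarith
  -- Dividing `(𝒜 - ℬ) v = (μ - 1) ℬ v` by `μ - 1` puts the eigenvector into the system with `|s| ≤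
  -- 1`.
  refine hv.2 (H.complex_system_eq_zero hτ hα hβ (s := (μ - 1)⁻¹) ?_ ?_)
  · rw [norm_inv]
    exact inv_le_one_of_one_le₀ hlt
  · have e : (blockMatrix τ A B M).map (algebraMap ℝ ℂ) *ᵥ v =
        μ • (blockMatrix τ A B N).map (algebraMap ℝ ℂ) *ᵥ v := by
      rw [← mulVec_smul, ← hv1, mulVec_mulVec, ← Matrix.map_mul, mul_nonsing_inv_cancel_left _ _ hdet]
    rw [Matrix.map_sub _ (map_sub _), sub_mulVec, e]
    nth_rewrite 3 [← one_smul ℂ ((blockMatrix τ A B N).map (algebraMap ℝ ℂ) *ᵥ v)]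
    rw [← sub_smul, smul_smul, inv_mul_cancel₀ hne, one_smul]

end IsLumpedPair

theorem spectralRadius_lt_two_of_norm_sub_one_lt [DecidableEq ι] (S : Matrix ι ι ℂ)
    (h : ∀ μ ∈ spectrum ℂ S, ‖μ - 1‖ < 1) : spectralRadius ℂ S < 2 := by
  have hfin : (spectrum ℂ S).Finite := by
    rw [← spectrum_toLin']
    exact Module.End.finite_spectrum _
  rw [spectralRadius, ← hfin.coe_toFinset]
  simp only [Finset.mem_coe]
  -- Finiteness of the spectrum keeps the inequality strict in the supremum; an empty spectrum gives
  -- `0 < 2`.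
  rw [← Finset.sup_eq_iSup, Finset.sup_lt_iff (by simp)]
  intro μ hμ
  have h1 := h μ (hfin.mem_toFinset.1 hμ)
  have h2 : ‖μ‖ < 2 := by
    calc ‖μ‖ = ‖(μ - 1) + 1‖ := by rw [sub_add_cancel]
      _ ≤ ‖μ - 1‖ + ‖(1 : ℂ)‖ := norm_add_le _ _
      _ < 2 := by rw [norm_one]; linarith
  have h3 : ‖μ‖₊ < 2 := h2
  exact_mod_cast h3

end LinearAlgebra

/-! ### Vertex exchange in a simplex and integrals of barycentric coordinates. -/

section AffineBasis

variable {ι E : Type*} [NormedAddCommGroup E] [NormedSpace ℝ E]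

/-- Moving `x` along the edge from `b i` to `b j` by the difference of the two coordinates exchanges
them and leaves the others unchanged. -/
theorem coord_swap (b : AffineBasis ι ℝ E) {i j : ι} (hij : i ≠ j) (k : ι) (x : E) [DecidableEq ι] :
    b.coord k (x + (b.coord i x - b.coord j x) • (b j - b i)) = b.coord (Equiv.swap i j k) x := by
  have hl : ∀ (x y : E), (b.coord k).linear (x - y) = b.coord k x - b.coord k y := fun x y => by
    simpa using (b.coord k).linearMap_vsub x y
  have h := (b.coord k).map_vadd x ((b.coord i x - b.coord j x) • (b j - b i))
  rw [vadd_eq_add, vadd_eq_add, map_smul, hl, smul_eq_mul] at h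
  rw [add_comm, h]
  simp only [AffineBasis.coord_apply]
  by_cases hki : k = i
  · subst hki
    simp [hij]
  · by_cases hkj : k = j
    · subst hkj
      simp [hij.symm]
    · simp [hki, hkj, Equiv.swap_apply_of_ne_of_ne]

variable [Fintype ι] [FiniteDimensional ℝ E] [MeasurableSpace E] [BorelSpace E]

/-- The affine involution that exchanges two vertices of a simplex preserves Haar measure. -/
theorem measurePreserving_swap (μ : Measure E) [μ.IsAddHaarMeasure] (b : AffineBasis ι ℝ E)
    {i j : ι} (hij : i ≠ j) :
    MeasurePreserving (fun x => x + (b.coord i x - b.coord j x) • (b j - b i)) μ μ := by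
  classical
  set f : Module.Dual ℝ E := (b.coord j).linear - (b.coord i).linear with hf
  have hl : ∀ k (x y : E), (b.coord k).linear (x - y) = b.coord k x - b.coord k y := fun k x y => by
    simpa using (b.coord k).linearMap_vsub x y
  have h2 : f (b j - b i) = 2 := by
    rw [hf, LinearMap.sub_apply, hl, hl]
    simp [hij, hij.symm]
    norm_num
  set L := Module.reflection h2
  -- The linear part is an involution, so its determinant is `±1`; the rest of the map is a
  -- translation.
  have hLL : (L : E →ₗ[ℝ] E) * (L : E →ₗ[ℝ] E) = 1 := by
    ext x
    simp [L, Module.reflection_apply, h2]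
    module
  have hdet : LinearMap.det (L : E →ₗ[ℝ] E) * LinearMap.det (L : E →ₗ[ℝ] E) = 1 := by
    rw [← map_mul, hLL, map_one]
  have hL : MeasurePreserving (L : E → E) μ μ := by
    refine ⟨(LinearMap.continuous_of_finiteDimensional (L : E →ₗ[ℝ] E)).measurable, ?_⟩
    have := Measure.map_linearMap_addHaar_eq_smul_addHaar μ (f := (L : E →ₗ[ℝ] E))
      (left_ne_zero_of_mul_eq_one hdet)
    have habs : |(LinearMap.det (L : E →ₗ[ℝ] E))⁻¹| = 1 := by
      rcases mul_self_eq_one_iff.1 hdet with h | h <;> simp [h]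
    rw [habs] at this
    simpa using this
  have hT : (fun x => x + (b.coord i x - b.coord j x) • (b j - b i)) =
      (fun x => x + (b.coord i 0 - b.coord j 0) • (b j - b i)) ∘ (L : E → E) := by
    ext x
    have hi := hl i x 0
    have hj := hl j x 0
    rw [sub_zero] at hi hj
    simp only [Function.comp, L, Module.reflection_apply, hf, LinearMap.sub_apply, hi, hj]
    module
  rw [hT]
  exact (measurePreserving_add_right μ _).comp hL

/-- The barycentric coordinates of a simplex all have the same integral. -/
theorem setIntegral_coord_eq (μ : Measure E) [μ.IsAddHaarMeasure] (b : AffineBasis ι ℝ E)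
    (i j : ι) :
    ∫ x in interior (convexHull ℝ (Set.range b)), b.coord i x ∂μ =
      ∫ x in interior (convexHull ℝ (Set.range b)), b.coord j x ∂μ := by
  classical
  rcases eq_or_ne i j with rfl | hij
  · rfl
  set T : E → E := fun x => x + (b.coord i x - b.coord j x) • (b j - b i) with hT
  have hinv : Function.Involutive T := by
    intro x
    simp only [hT]
    rw [coord_swap b hij, coord_swap b hij]
    simp only [Equiv.swap_apply_left, Equiv.swap_apply_right]
    module
  have hc : Continuous T := by
    have := fun k => (b.coord k).continuous_of_finiteDimensional
    fun_prop
  let e : E ≃ₜ E := ⟨hinv.toPerm T, hc, hc⟩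
  have hmp : MeasurePreserving T μ μ := measurePreserving_swap μ b hij
  have he : MeasurableEmbedding T := e.measurableEmbedding
  have hpre : T ⁻¹' interior (convexHull ℝ (Set.range b)) =
      interior (convexHull ℝ (Set.range b)) := by
    ext x
    rw [b.interior_convexHull]
    simp only [Set.mem_preimage, Set.mem_ofPred_eq, hT, coord_swap b hij]
    exact (Equiv.swap i j).forall_congr_right (q := fun k => 0 < b.coord k x)
  have h := hmp.setIntegral_preimage_emb he (b.coord j)
    (interior (convexHull ℝ (Set.range b)))
  rw [hpre] at h
  rw [← h]
  refine setIntegral_congr_fun isOpen_interior.measurableSet fun x _ => ?_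
  simp [hT, coord_swap b hij]

end AffineBasis


theorem IsPolyhedralDomain.volume_frontier {d : ℕ} {Ω : Set (Pt d)} (hΩ : IsPolyhedralDomain Ω) :
    volume (frontier Ω) = 0 := by
  obtain ⟨S, hS, hne, hsub⟩ := hΩ.polyhedral
  refine measure_mono_null hsub ((measure_biUnion_null_iff hS.countable).2 fun H hH => ?_)
  exact Measure.addHaar_affineSubspace volume H (hne H hH)

/-! ### Element geometry: open cells, local coordinates, local mass matrices. -/

namespace Triangulation

variable {d : ℕ} {Ω : Set (Pt d)} (T : Triangulation Ω)

/-- The interior of an element. -/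
def openCell (K : T.cells) : Set (Pt d) := interior (convexHull ℝ ((K : Finset (Pt d)) : Set (Pt d)))

open Classical in
/-- The affine function on `ℝ^d` that agrees with the hat function of `z` on the element `K`. -/
noncomputable def localCoord (K : T.cells) (z : Pt d) : Pt d →ᵃ[ℝ] ℝ :=
  if h : z ∈ (K : Finset (Pt d)) then (T.cellBasis K).coord ⟨z, h⟩ else 0

/-- The gradient on the element `K` of the hat function of `z`. -/
noncomputable def localGrad (K : T.cells) (z : Pt d) : Pt d :=
  (InnerProductSpace.toDual ℝ (Pt d)).symm
    (LinearMap.toContinuousLinearMap (T.localCoord K z).linear)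

/-- The entries of the element mass matrix. -/
noncomputable def localMass (K : T.cells) (z w : Pt d) : ℝ :=
  ∫ x in T.openCell K, T.localCoord K z x * T.localCoord K w x

theorem range_cellBasis (K : T.cells) :
    Set.range (T.cellBasis K) = ((K : Finset (Pt d)) : Set (Pt d)) := Subtype.range_coe

theorem isOpen_openCell (K : T.cells) : IsOpen (T.openCell K) := isOpen_interior

theorem openCell_subset (K : T.cells) :
    T.openCell K ⊆ convexHull ℝ ((K : Finset (Pt d)) : Set (Pt d)) := interior_subset

theorem isCompact_cell (K : T.cells) :
    IsCompact (convexHull ℝ ((K : Finset (Pt d)) : Set (Pt d))) :=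
  (K : Finset (Pt d)).finite_toSet.isCompact_convexHull ℝ

theorem volume_openCell_ne_top (K : T.cells) : volume (T.openCell K) ≠ ⊤ :=
  ((measure_mono (T.openCell_subset K)).trans_lt (T.isCompact_cell K).measure_lt_top).ne

theorem volume_openCell_pos (K : T.cells) : 0 < volume.real (T.openCell K) := by
  refine ENNReal.toReal_pos ((T.isOpen_openCell K).measure_pos _ ?_).ne' (T.volume_openCell_ne_top K)
  have := (T.cellBasis K).centroid_mem_interior_convexHull
  rw [range_cellBasis] at this
  exact ⟨_, this⟩

theorem openCell_ae_eq (K : T.cells) :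
    T.openCell K =ᵐ[volume] convexHull ℝ ((K : Finset (Pt d)) : Set (Pt d)) :=
  interior_ae_eq_of_null_frontier ((convex_convexHull ℝ _).addHaar_frontier volume)

theorem volume_real_cell (K : T.cells) :
    volume.real (convexHull ℝ ((K : Finset (Pt d)) : Set (Pt d))) = volume.real (T.openCell K) :=
  (measureReal_congr (T.openCell_ae_eq K)).symm

theorem localCoord_of_mem {K : T.cells} {z : Pt d} (h : z ∈ (K : Finset (Pt d))) :
    T.localCoord K z = (T.cellBasis K).coord ⟨z, h⟩ := dif_pos h

theorem localCoord_of_notMem {K : T.cells} {z : Pt d} (h : z ∉ (K : Finset (Pt d))) :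
    T.localCoord K z = 0 := dif_neg h

theorem hat_eq_localCoord (K : T.cells) (z : Pt d) {x : Pt d}
    (hx : x ∈ convexHull ℝ ((K : Finset (Pt d)) : Set (Pt d))) :
    T.hat z x = T.localCoord K z x := by
  by_cases h : z ∈ (K : Finset (Pt d))
  · rw [T.localCoord_of_mem h, T.hat_eq_coord K h hx]
  · rw [T.localCoord_of_notMem h, T.hat_eq_zero K h hx]
    rfl

theorem localCoord_vertex (K : T.cells) (z : Pt d) {w : Pt d} (hw : w ∈ (K : Finset (Pt d)))
    [Decidable (z = w)] : T.localCoord K z w = if z = w then 1 else 0 := by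
  classical
  by_cases h : z ∈ (K : Finset (Pt d))
  · rw [T.localCoord_of_mem h]
    change (T.cellBasis K).coord ⟨z, h⟩ (T.cellBasis K ⟨w, hw⟩) = _
    rw [AffineBasis.coord_apply]
    simp
  · rw [T.localCoord_of_notMem h, if_neg]
    · rfl
    · rintro rfl
      exact h hw

theorem sum_localCoord (K : T.cells) (x : Pt d) :
    ∑ z ∈ (K : Finset (Pt d)), T.localCoord K z x = 1 := by
  rw [← (T.cellBasis K).sum_coord_apply_eq_one x, ← Finset.sum_coe_sort]
  exact Finset.sum_congr rfl fun z _ => by rw [T.localCoord_of_mem z.2]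

theorem localCoord_pos {K : T.cells} {z : Pt d} (h : z ∈ (K : Finset (Pt d))) {x : Pt d}
    (hx : x ∈ T.openCell K) : 0 < T.localCoord K z x := by
  rw [openCell, ← range_cellBasis, AffineBasis.interior_convexHull] at hx
  rw [T.localCoord_of_mem h]
  exact hx _

theorem localCoord_nonneg (K : T.cells) (z : Pt d) {x : Pt d} (hx : x ∈ T.openCell K) :
    0 ≤ T.localCoord K z x := by
  by_cases h : z ∈ (K : Finset (Pt d))
  · exact (T.localCoord_pos h hx).le
  · rw [T.localCoord_of_notMem h]
    rfl

theorem continuous_localCoord (K : T.cells) (z : Pt d) : Continuous (T.localCoord K z) :=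
  (T.localCoord K z).continuous_of_finiteDimensional

theorem integrableOn_openCell (K : T.cells) {f : Pt d → ℝ} (hf : Continuous f) :
    IntegrableOn f (T.openCell K) :=
  (hf.continuousOn.integrableOn_compact (T.isCompact_cell K)).mono_set (T.openCell_subset K)

theorem integrableOn_localCoord_mul (K : T.cells) (z w : Pt d) :
    IntegrableOn (fun x => T.localCoord K z x * T.localCoord K w x) (T.openCell K) :=
  T.integrableOn_openCell K ((T.continuous_localCoord K z).mul (T.continuous_localCoord K w))

theorem inner_localGrad (K : T.cells) (z : Pt d) (u v : Pt d) :
    inner ℝ (T.localGrad K z) (u - v) = T.localCoord K z u - T.localCoord K z v := by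
  rw [localGrad, InnerProductSpace.toDual_symm_apply, LinearMap.coe_toContinuousLinearMap']
  simpa using (T.localCoord K z).linearMap_vsub u v

theorem gradient_hat (K : T.cells) (z : Pt d) {x : Pt d} (hx : x ∈ T.openCell K) :
    gradient (T.hat z) x = T.localGrad K z := by
  have he : T.hat z =ᶠ[nhds x] T.localCoord K z := by
    filter_upwards [(T.isOpen_openCell K).mem_nhds hx] with y hy
    exact T.hat_eq_localCoord K z (T.openCell_subset K hy)
  rw [gradient, he.fderiv_eq, localGrad]
  congr 1
  have hd : ⇑(T.localCoord K z) = fun y =>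
      LinearMap.toContinuousLinearMap (T.localCoord K z).linear y + T.localCoord K z 0 := by
    ext y
    exact congrFun (T.localCoord K z).decomp y
  rw [hd]
  exact ((LinearMap.toContinuousLinearMap (T.localCoord K z).linear).hasFDerivAt.add_const _).fderiv

/-- By conformity the overlap lies in the affine span of the common vertices. These are fewer than
`d + 1`, so the span is a null set, and an open null set is empty. -/
theorem disjoint_openCell {K L : T.cells} (h : K ≠ L) :
    Disjoint (T.openCell K) (T.openCell L) := by
  have hK := T.mem_cells.1 K.2
  have hL := T.mem_cells.1 L.2
  classical
  rw [Set.disjoint_iff_inter_eq_empty]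
  refine IsOpen.eq_empty_of_measure_zero (μ := (volume : Measure (Pt d)))
    ((T.isOpen_openCell K).inter (T.isOpen_openCell L)) ?_
  have hsub : T.openCell K ∩ T.openCell L ⊆
      affineSpan ℝ (((K : Finset (Pt d)) ∩ (L : Finset (Pt d)) : Finset (Pt d)) : Set (Pt d)) := by
    rw [Finset.coe_inter]
    exact (Set.inter_subset_inter (T.openCell_subset K) (T.openCell_subset L)).trans
      ((T.inter_subset_convexHull hK.1 hL.1).trans (convexHull_subset_affineSpan _))
  refine measure_mono_null hsub (Measure.addHaar_affineSubspace volume _ fun htop => ?_)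
  have hlt : ((K : Finset (Pt d)) ∩ (L : Finset (Pt d))).card < d + 1 := by
    rw [← hK.2]
    refine Finset.card_lt_card ⟨Finset.inter_subset_left, fun hc => h (Subtype.ext ?_)⟩
    exact Finset.eq_of_subset_of_card_le (hc.trans Finset.inter_subset_right) (by rw [hK.2, hL.2])
  have hind : AffineIndependent ℝ
      ((↑) : ((K : Finset (Pt d)) ∩ (L : Finset (Pt d)) : Finset (Pt d)) → Pt d) :=
    (T.indep hK.1).mono (Finset.coe_subset.2 Finset.inter_subset_left)
  rw [← Subtype.range_coe (s := (((K : Finset (Pt d)) ∩ (L : Finset (Pt d)) : Finset (Pt d)) :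
    Set (Pt d)))] at htop
  have := (hind.affineSpan_eq_top_iff_card_eq_finrank_add_one).1 htop
  simp only [Fintype.card_coe, finrank_euclideanSpace, Fintype.card_fin] at this
  omega

/-- Both the boundary of the domain and the boundaries of the convex elements are null sets, and
purity lets the elements alone cover the closure. -/
theorem ae_eq_iUnion_openCell (hΩ : IsPolyhedralDomain Ω) :
    Ω =ᵐ[volume] ⋃ K, T.openCell K := by
  have h₁ : closure Ω = ⋃ K : T.cells, convexHull ℝ ((K : Finset (Pt d)) : Set (Pt d)) := by
    rw [← T.space_eq]
    refine Set.Subset.antisymm ?_ ?_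
    · refine Set.iUnion₂_subset fun s hs => ?_
      obtain ⟨t, ht, hst, hcard⟩ := T.pure s hs
      exact (convexHull_mono (Finset.coe_subset.2 hst)).trans
        (Set.subset_iUnion (fun K : T.cells => convexHull ℝ ((K : Finset (Pt d)) : Set (Pt d)))
          ⟨t, T.mem_cells.2 ⟨ht, hcard⟩⟩)
    · exact Set.iUnion_subset fun K =>
        Set.subset_iUnion₂_of_subset _ (T.mem_cells.1 K.2).1 subset_rfl
  have h₂ : Ω =ᵐ[volume] closure Ω :=
    (closure_ae_eq_of_null_frontier hΩ.volume_frontier).symm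
  rw [h₁] at h₂
  exact h₂.trans (Filter.EventuallyEq.countable_iUnion fun K => T.openCell_ae_eq K).symm

theorem restrict_eq (hΩ : IsPolyhedralDomain Ω) :
    (volume : Measure (Pt d)).restrict Ω = volume.restrict (⋃ K, T.openCell K) :=
  Measure.restrict_congr_set (T.ae_eq_iUnion_openCell hΩ)

theorem setIntegral_eq_sum (hΩ : IsPolyhedralDomain Ω) {f : Pt d → ℝ}
    {g : T.cells → Pt d → ℝ} (hg : ∀ K, IntegrableOn (g K) (T.openCell K))
    (hfg : ∀ K, Set.EqOn f (g K) (T.openCell K)) :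
    ∫ x in Ω, f x = ∑ K, ∫ x in T.openCell K, g K x := by
  have hm := fun K => (T.isOpen_openCell K).measurableSet
  have hf : ∀ K, IntegrableOn f (T.openCell K) := fun K =>
    (hg K).congr_fun (hfg K).symm (hm K)
  rw [T.restrict_eq hΩ, integral_iUnion_fintype hm (fun K L h => T.disjoint_openCell h) hf]
  exact Finset.sum_congr rfl fun K _ => setIntegral_congr_fun (hm K) (hfg K)

theorem localMass_comm (K : T.cells) (z w : Pt d) : T.localMass K z w = T.localMass K w z := by
  simp only [localMass, mul_comm]

theorem localMass_of_notMem {K : T.cells} {z : Pt d} (h : z ∉ (K : Finset (Pt d))) (w : Pt d) :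
    T.localMass K z w = 0 := by
  simp [localMass, T.localCoord_of_notMem h]

theorem localMass_nonneg (K : T.cells) (z w : Pt d) : 0 ≤ T.localMass K z w :=
  setIntegral_nonneg (T.isOpen_openCell K).measurableSet fun _ hx =>
    mul_nonneg (T.localCoord_nonneg K z hx) (T.localCoord_nonneg K w hx)

theorem localMass_self_pos {K : T.cells} {z : Pt d} (h : z ∈ (K : Finset (Pt d))) :
    0 < T.localMass K z z := by
  have hpos : ∀ x ∈ T.openCell K, 0 < T.localCoord K z x * T.localCoord K z x := fun x hx =>
    mul_pos (T.localCoord_pos h hx) (T.localCoord_pos h hx)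
  rw [localMass, setIntegral_pos_iff_support_of_nonneg_ae
    (ae_restrict_of_forall_mem (T.isOpen_openCell K).measurableSet fun x hx => (hpos x hx).le)
    (T.integrableOn_localCoord_mul K z z)]
  rw [Set.inter_eq_self_of_subset_right fun x hx => Function.mem_support.2 (hpos x hx).ne']
  exact (ENNReal.toReal_pos_iff.1 (T.volume_openCell_pos K)).1

theorem sum_localMass (K : T.cells) (z : Pt d) :
    ∑ w ∈ (K : Finset (Pt d)), T.localMass K z w = ∫ x in T.openCell K, T.localCoord K z x := by
  simp only [localMass]
  rw [← integral_finsetSum _ fun w _ => T.integrableOn_localCoord_mul K z w]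
  simp only [← Finset.mul_sum, T.sum_localCoord, mul_one]

theorem sum_integral_localCoord (K : T.cells) :
    ∑ z ∈ (K : Finset (Pt d)), ∫ x in T.openCell K, T.localCoord K z x =
      volume.real (T.openCell K) := by
  rw [← integral_finsetSum _ fun w _ => T.integrableOn_openCell K (T.continuous_localCoord K w)]
  simp [T.sum_localCoord]

/-- The `d + 1` coordinates have equal integrals and sum to `1`. -/
theorem integral_localCoord {K : T.cells} {z : Pt d} (h : z ∈ (K : Finset (Pt d))) :
    ∫ x in T.openCell K, T.localCoord K z x = volume.real (T.openCell K) / (d + 1) := by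
  have hc : ∀ w ∈ (K : Finset (Pt d)), ∫ x in T.openCell K, T.localCoord K w x =
      ∫ x in T.openCell K, T.localCoord K z x := by
    intro w hw
    have := setIntegral_coord_eq volume (T.cellBasis K) ⟨w, hw⟩ ⟨z, h⟩
    rwa [range_cellBasis, ← localCoord_of_mem, ← localCoord_of_mem] at this
  rw [← T.sum_integral_localCoord K, Finset.sum_congr rfl hc, Finset.sum_const,
    (T.mem_cells.1 K.2).2]
  have : (d : ℝ) + 1 ≠ 0 := by positivity
  push_cast [nsmul_eq_mul]
  field_simp

theorem diam_le_meshSize (K : T.cells) :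
    Metric.diam (convexHull ℝ ((K : Finset (Pt d)) : Set (Pt d))) ≤ T.meshSize :=
  le_ciSup (f := fun s : T.cells => Metric.diam (convexHull ℝ ((s : Finset (Pt d)) : Set (Pt d))))
    (Set.finite_range _).bddAbove K

theorem dist_le_meshSize (K : T.cells) {z w : Pt d} (hz : z ∈ (K : Finset (Pt d)))
    (hw : w ∈ (K : Finset (Pt d))) : dist z w ≤ T.meshSize :=
  (Metric.dist_le_diam_of_mem (T.isCompact_cell K).isBounded
    (subset_convexHull ℝ _ hz) (subset_convexHull ℝ _ hw)).trans (T.diam_le_meshSize K)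

theorem exists_mem_cell {z : Pt d} (hz : z ∈ T.vertices) :
    ∃ K : T.cells, z ∈ (K : Finset (Pt d)) := by
  obtain ⟨t, ht, hzt, hcard⟩ := T.pure {z} hz
  exact ⟨⟨t, T.mem_cells.2 ⟨ht, hcard⟩⟩, hzt (Finset.mem_singleton_self z)⟩

theorem meshSize_pos (hd : 1 ≤ d) (hΩ : Ω.Nonempty) : 0 < T.meshSize := by
  obtain ⟨x, hx⟩ := hΩ
  have hx' := subset_closure hx
  rw [← T.space_eq] at hx'
  obtain ⟨s, hs, -⟩ := Set.mem_iUnion₂.1 hx'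
  obtain ⟨t, ht, -, hcard⟩ := T.pure s hs
  obtain ⟨z, hz, w, hw, hne⟩ := Finset.one_lt_card.1 (show 1 < t.card by omega)
  exact (dist_pos.2 hne).trans_le (T.dist_le_meshSize ⟨t, T.mem_cells.2 ⟨ht, hcard⟩⟩ hz hw)

end Triangulation

/-- The lumping error of a symmetric form is a sum of products of differences. -/
theorem two_mul_sum_lumping {α : Type*} (S : Finset α) (m : α → α → ℝ) (hm : ∀ z w, m z w = m w z)
    (u v : α → ℝ) :
    2 * (∑ z ∈ S, ∑ w ∈ S, u z * m z w * v w - ∑ z ∈ S, u z * (∑ w ∈ S, m z w) * v z) =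
      -∑ z ∈ S, ∑ w ∈ S, m z w * ((u z - u w) * (v z - v w)) := by
  -- Expanding the product of differences gives two diagonal and two mixed terms, which agree in
  -- pairs after exchanging `z` and `w`.
  have h₁ : ∑ z ∈ S, ∑ w ∈ S, u w * m z w * v z = ∑ z ∈ S, ∑ w ∈ S, u z * m z w * v w := by
    rw [Finset.sum_comm]
    simp only [fun z w => hm w z]
  have h₂ : ∑ z ∈ S, ∑ w ∈ S, m z w * (u w * v w) = ∑ z ∈ S, ∑ w ∈ S, m z w * (u z * v z) := by
    rw [Finset.sum_comm]
    simp only [fun z w => hm w z]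
  have h₃ : ∑ z ∈ S, u z * (∑ w ∈ S, m z w) * v z = ∑ z ∈ S, ∑ w ∈ S, m z w * (u z * v z) := by
    refine Finset.sum_congr rfl fun z _ => ?_
    rw [Finset.mul_sum, Finset.sum_mul]
    exact Finset.sum_congr rfl fun w _ => by ring
  have h₄ : ∑ z ∈ S, ∑ w ∈ S, m z w * ((u z - u w) * (v z - v w)) =
      ∑ z ∈ S, ∑ w ∈ S, m z w * (u z * v z) - ∑ z ∈ S, ∑ w ∈ S, u z * m z w * v w -
        ∑ z ∈ S, ∑ w ∈ S, u w * m z w * v z + ∑ z ∈ S, ∑ w ∈ S, m z w * (u w * v w) := by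
    simp only [← Finset.sum_sub_distrib, ← Finset.sum_add_distrib]
    exact Finset.sum_congr rfl fun z _ => Finset.sum_congr rfl fun w _ => by ring
  rw [h₄, h₁, h₂, h₃]
  ring

/-- The integral over a set of a matrix-valued function, entry by entry. -/
noncomputable def integralMatrix {d : ℕ} (a : Pt d → Matrix (Fin d) (Fin d) ℝ) (V : Set (Pt d)) :
    Matrix (Fin d) (Fin d) ℝ :=
  Matrix.of fun k l => ∫ x in V, a x k l

/-! ### Element averages of the coefficient: gradients are constant on each element, so only
entrywise integrals matter. -/

section IntegralMatrix

open Matrix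

variable {d : ℕ} {a : Pt d → Matrix (Fin d) (Fin d) ℝ} {V : Set (Pt d)}

theorem integrableOn_mulVec_dotProduct (ha : ∀ k l, IntegrableOn (fun x => a x k l) V)
    (u v : Fin d → ℝ) : IntegrableOn (fun x => (a x *ᵥ u) ⬝ᵥ v) V := by
  simp only [mulVec, dotProduct]
  exact integrable_finsetSum _ fun k _ =>
    (integrable_finsetSum _ fun l _ => (ha k l).mul_const _).mul_const _

theorem setIntegral_mulVec_dotProduct (ha : ∀ k l, IntegrableOn (fun x => a x k l) V)
    (u v : Fin d → ℝ) : ∫ x in V, (a x *ᵥ u) ⬝ᵥ v = (integralMatrix a V *ᵥ u) ⬝ᵥ v := by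
  simp only [mulVec, dotProduct, integralMatrix, of_apply]
  rw [integral_finsetSum _ fun k _ =>
    (integrable_finsetSum _ fun l _ => (ha k l).mul_const _).mul_const _]
  refine Finset.sum_congr rfl fun k _ => ?_
  rw [integral_mul_const, integral_finsetSum _ fun l _ => (ha k l).mul_const _]
  simp only [integral_mul_const]

theorem integralMatrix_coercive {c : ℝ} (hV : volume V ≠ ⊤)
    (ha : ∀ k l, IntegrableOn (fun x => a x k l) V)
    (hc : ∀ᵐ x ∂(volume.restrict V), ∀ ξ : Fin d → ℝ, c * (ξ ⬝ᵥ ξ) ≤ ξ ⬝ᵥ (a x *ᵥ ξ))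
    (ξ : Fin d → ℝ) :
    c * (volume.real V * (ξ ⬝ᵥ ξ)) ≤ (integralMatrix a V *ᵥ ξ) ⬝ᵥ ξ := by
  rw [← setIntegral_mulVec_dotProduct ha]
  calc c * (volume.real V * (ξ ⬝ᵥ ξ)) = ∫ _ in V, c * (ξ ⬝ᵥ ξ) := by
        rw [setIntegral_const, smul_eq_mul]
        ring
    _ ≤ ∫ x in V, (a x *ᵥ ξ) ⬝ᵥ ξ := by
        refine integral_mono_ae (integrableOn_const hV) (integrableOn_mulVec_dotProduct ha ξ ξ) ?_
        filter_upwards [hc] with x hx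
        rw [dotProduct_comm (a x *ᵥ ξ)]
        exact hx ξ

end IntegralMatrix

/-! ### Finite element functions, their element gradients and their energy. -/

namespace Triangulation

open Matrix

variable {d : ℕ} {Ω : Set (Pt d)} (T : Triangulation Ω) (Γ : Set (Pt d))

open Classical in
/-- The degrees of freedom as a finite set of points. -/
noncomputable def nodes : Finset (Pt d) := Finset.univ.image fun i : T.Node Γ => i.1

theorem node_mem_nodes (i : T.Node Γ) : i.1 ∈ T.nodes Γ := by
  classical
  exact Finset.mem_image_of_mem _ (Finset.mem_univ i)

open Classical in
/-- The vertex values of the finite element function with coefficient vector `x`. -/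
noncomputable def vertexValue (x : T.Node Γ → ℝ) (z : Pt d) : ℝ :=
  if h : z ∈ T.vertices ∧ z ∉ Γ then x (show T.Node Γ from Subtype.mk z h) else 0

theorem vertexValue_node (x : T.Node Γ → ℝ) (i : T.Node Γ) : T.vertexValue Γ x i.1 = x i :=
  dif_pos i.2

theorem vertexValue_of_notMem (x : T.Node Γ → ℝ) {z : Pt d} (h : z ∉ T.nodes Γ) :
    T.vertexValue Γ x z = 0 := by
  classical
  exact dif_neg fun hz => h (Finset.mem_image.2 ⟨Subtype.mk z hz, Finset.mem_univ _, rfl⟩)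

/-- Passes from sums over all degrees of freedom to sums over vertices of one element; `f` vanishes
on the symmetric difference. -/
theorem sum_node_eq {R : Type*} [AddCommMonoid R] (f : Pt d → R) {S : Finset (Pt d)}
    (h₁ : ∀ z ∈ T.nodes Γ, z ∉ S → f z = 0) (h₂ : ∀ z ∈ S, z ∉ T.nodes Γ → f z = 0) :
    ∑ i : T.Node Γ, f i.1 = ∑ z ∈ S, f z := by
  classical
  have h : ∑ i : T.Node Γ, f i.1 = ∑ z ∈ T.nodes Γ, f z :=
    (Finset.sum_image (g := fun i : T.Node Γ => i.1) fun i _ j _ hij => Subtype.ext hij).symm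
  rw [h, ← Finset.sum_subset (Finset.inter_subset_left : T.nodes Γ ∩ S ⊆ T.nodes Γ)
      fun z hz hzS => h₁ z hz fun hS => hzS (Finset.mem_inter.2 ⟨hz, hS⟩),
    ← Finset.sum_subset (Finset.inter_subset_right : T.nodes Γ ∩ S ⊆ S)
      fun z hz hzS => h₂ z hz fun hN => hzS (Finset.mem_inter.2 ⟨hN, hz⟩)]

/-- The gradient on the element `K` of the finite element function with coefficient vector `x`. -/
noncomputable def cellGrad (K : T.cells) (x : T.Node Γ → ℝ) : Pt d :=
  ∑ i, x i • T.localGrad K i.1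

/-- The squared `L²` norm of the gradient of a finite element function. -/
noncomputable def energy (x : T.Node Γ → ℝ) : ℝ :=
  ∑ K, volume.real (T.openCell K) * ‖T.cellGrad Γ K x‖ ^ 2

theorem energy_nonneg (x : T.Node Γ → ℝ) : 0 ≤ T.energy Γ x :=
  Finset.sum_nonneg fun _ _ => mul_nonneg measureReal_nonneg (sq_nonneg _)

theorem cellGrad_eq_zero_of_energy {x : T.Node Γ → ℝ} (h : T.energy Γ x = 0) (K : T.cells) :
    T.cellGrad Γ K x = 0 := by
  have := (Finset.sum_eq_zero_iff_of_nonneg fun K _ =>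
    mul_nonneg measureReal_nonneg (sq_nonneg ‖T.cellGrad Γ K x‖)).1 h K (Finset.mem_univ K)
  simpa [(T.volume_openCell_pos K).ne'] using this

/-- The function is affine on `K` and its value at each vertex of `K` is `vertexValue`, which is `0`
at Dirichlet vertices. -/
theorem inner_cellGrad (K : T.cells) (x : T.Node Γ → ℝ) {z w : Pt d}
    (hz : z ∈ (K : Finset (Pt d))) (hw : w ∈ (K : Finset (Pt d))) :
    inner ℝ (T.cellGrad Γ K x) (z - w) = T.vertexValue Γ x z - T.vertexValue Γ x w := by
  classical
  have key : ∀ y ∈ (K : Finset (Pt d)), ∑ i, x i * T.localCoord K i.1 y = T.vertexValue Γ x y := by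
    intro y hy
    have := T.sum_node_eq Γ (fun z => T.vertexValue Γ x z * T.localCoord K z y)
      (S := (K : Finset (Pt d)))
      (fun z _ hz => by rw [T.localCoord_of_notMem hz]; exact mul_zero _)
      (fun z _ hz => by rw [T.vertexValue_of_notMem Γ x hz, zero_mul])
    simp only [vertexValue_node] at this
    rw [this, Finset.sum_eq_single_of_mem y hy fun z _ hzy => by
      rw [T.localCoord_vertex K z hy, if_neg hzy, mul_zero], T.localCoord_vertex K y hy, if_pos rfl,
      mul_one]
  rw [← key z hz, ← key w hw, cellGrad, sum_inner, ← Finset.sum_sub_distrib]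
  refine Finset.sum_congr rfl fun i _ => ?_
  rw [real_inner_smul_left, T.inner_localGrad, mul_sub]

theorem abs_vertexValue_sub_le (K : T.cells) (x : T.Node Γ → ℝ) {z w : Pt d}
    (hz : z ∈ (K : Finset (Pt d))) (hw : w ∈ (K : Finset (Pt d))) :
    |T.vertexValue Γ x z - T.vertexValue Γ x w| ≤ ‖T.cellGrad Γ K x‖ * T.meshSize := by
  rw [← T.inner_cellGrad Γ K x hz hw]
  refine (abs_real_inner_le_norm _ _).trans (mul_le_mul_of_nonneg_left ?_ (norm_nonneg _))
  rw [← dist_eq_norm]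
  exact T.dist_le_meshSize K hz hw

/-! ### Stiffness matrices: element decomposition and coercivity. -/

section Stiffness

variable {a : Pt d → Matrix (Fin d) (Fin d) ℝ} {c : ℝ}

theorem integrableOn_coefficient (hΩ : IsPolyhedralDomain Ω) (ha : IsDiffusionCoefficient Ω a c)
    (K : T.cells) (k l : Fin d) : IntegrableOn (fun x => a x k l) (T.openCell K) := by
  have h := ha.integrable k l
  rw [IntegrableOn, T.restrict_eq hΩ] at h
  exact IntegrableOn.mono_set h (Set.subset_iUnion _ K)

theorem stiffnessMatrix_apply (hΩ : IsPolyhedralDomain Ω) (ha : IsDiffusionCoefficient Ω a c)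
    (i j : T.Node Γ) :
    T.stiffnessMatrix Γ a i j = ∑ K, (integralMatrix a (T.openCell K) *ᵥ
      (T.localGrad K i.1).ofLp) ⬝ᵥ (T.localGrad K j.1).ofLp := by
  rw [stiffnessMatrix, of_apply, T.setIntegral_eq_sum hΩ
    (g := fun K x => (a x *ᵥ (T.localGrad K i.1).ofLp) ⬝ᵥ (T.localGrad K j.1).ofLp)
    (fun K => integrableOn_mulVec_dotProduct (T.integrableOn_coefficient hΩ ha K) _ _)
    (fun K x hx => by simp only [phi, T.gradient_hat K _ hx])]
  exact Finset.sum_congr rfl fun K _ =>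
    setIntegral_mulVec_dotProduct (T.integrableOn_coefficient hΩ ha K) _ _

theorem ofLp_cellGrad (K : T.cells) (x : T.Node Γ → ℝ) :
    (T.cellGrad Γ K x).ofLp = ∑ i, x i • (T.localGrad K i.1).ofLp := by
  simp [cellGrad, WithLp.ofLp_sum]

theorem stiffnessMatrix_mulVec (hΩ : IsPolyhedralDomain Ω) (ha : IsDiffusionCoefficient Ω a c)
    (x : T.Node Γ → ℝ) (i : T.Node Γ) :
    (T.stiffnessMatrix Γ a *ᵥ x) i = ∑ K, (integralMatrix a (T.openCell K) *ᵥ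
      (T.localGrad K i.1).ofLp) ⬝ᵥ (T.cellGrad Γ K x).ofLp := by
  rw [mulVec, dotProduct]
  simp only [T.stiffnessMatrix_apply Γ hΩ ha, Finset.sum_mul]
  rw [Finset.sum_comm]
  refine Finset.sum_congr rfl fun K _ => ?_
  rw [ofLp_cellGrad, dotProduct_sum]
  refine Finset.sum_congr rfl fun j _ => ?_
  rw [dotProduct_smul, smul_eq_mul, mul_comm]

theorem dotProduct_stiffnessMatrix_mulVec (hΩ : IsPolyhedralDomain Ω)
    (ha : IsDiffusionCoefficient Ω a c) (x : T.Node Γ → ℝ) :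
    x ⬝ᵥ T.stiffnessMatrix Γ a *ᵥ x = ∑ K, (integralMatrix a (T.openCell K) *ᵥ
      (T.cellGrad Γ K x).ofLp) ⬝ᵥ (T.cellGrad Γ K x).ofLp := by
  rw [dotProduct]
  simp only [T.stiffnessMatrix_mulVec Γ hΩ ha, Finset.mul_sum]
  rw [Finset.sum_comm]
  refine Finset.sum_congr rfl fun K _ => ?_
  nth_rewrite 2 [ofLp_cellGrad]
  rw [mulVec_sum, sum_dotProduct]
  refine Finset.sum_congr rfl fun i _ => ?_
  rw [mulVec_smul, smul_dotProduct, smul_eq_mul]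

theorem stiffnessMatrix_coercive (hΩ : IsPolyhedralDomain Ω) (ha : IsDiffusionCoefficient Ω a c)
    (x : T.Node Γ → ℝ) : c * T.energy Γ x ≤ x ⬝ᵥ T.stiffnessMatrix Γ a *ᵥ x := by
  have hc := ha.coercive
  rw [T.restrict_eq hΩ] at hc
  rw [T.dotProduct_stiffnessMatrix_mulVec Γ hΩ ha, energy, Finset.mul_sum]
  refine Finset.sum_le_sum fun K _ => ?_
  have := integralMatrix_coercive (T.volume_openCell_ne_top K) (T.integrableOn_coefficient hΩ ha K)
    (ae_restrict_of_ae_restrict_of_subset (Set.subset_iUnion _ K) hc) (T.cellGrad Γ K x).ofLp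
  refine le_of_eq_of_le ?_ this
  rw [EuclideanSpace.real_norm_sq_eq]
  simp [dotProduct, sq]

/-- Zero energy kills every element gradient, hence every term of the product; no symmetry of `a` is
needed. -/
theorem stiffnessMatrix_mulVec_eq_zero (hΩ : IsPolyhedralDomain Ω)
    (ha : IsDiffusionCoefficient Ω a c) {x : T.Node Γ → ℝ} (hx : T.energy Γ x = 0) :
    T.stiffnessMatrix Γ a *ᵥ x = 0 := by
  ext i
  simp [T.stiffnessMatrix_mulVec Γ hΩ ha, T.cellGrad_eq_zero_of_energy Γ hx]

end Stiffness

/-! ### Mass lumping: both variants in one form, and the lumping error. -/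

/-- `N` is a diagonal matrix obtained by lumping the element mass matrices over sets of vertices
that contain all degrees of freedom of the element. -/
def IsLumping (N : Matrix (T.Node Γ) (T.Node Γ) ℝ) : Prop :=
  ∃ S : T.cells → Finset (Pt d), (∀ K, S K ⊆ K) ∧
    (∀ (K : T.cells) (i : T.Node Γ), i.1 ∈ (K : Finset (Pt d)) → i.1 ∈ S K) ∧
    N = Matrix.diagonal fun i => ∑ K, ∑ w ∈ S K, T.localMass K i.1 w

theorem massMatrix_apply (hΩ : IsPolyhedralDomain Ω) (i j : T.Node Γ) :
    T.massMatrix Γ i j = ∑ K, T.localMass K i.1 j.1 := by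
  rw [massMatrix, of_apply]
  exact T.setIntegral_eq_sum hΩ (fun K => T.integrableOn_localCoord_mul K i.1 j.1)
    fun K x hx => by simp only [phi, T.hat_eq_localCoord K _ (T.openCell_subset K hx)]

theorem isSymm_massMatrix : (T.massMatrix Γ).IsSymm := by
  ext i j
  simp [massMatrix, mul_comm]

theorem isLumping_rowSum (hΩ : IsPolyhedralDomain Ω) : T.IsLumping Γ (T.rowSumMassMatrix Γ) := by
  classical
  -- Row sums of `M` run over degrees of freedom only, so Dirichlet vertices are left out of the
  -- lumping set.
  refine ⟨fun K => (K : Finset (Pt d)) ∩ T.nodes Γ, fun K => Finset.inter_subset_left,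
    fun K i hi => Finset.mem_inter.2 ⟨hi, T.node_mem_nodes Γ i⟩, ?_⟩
  rw [rowSumMassMatrix]
  congr 1
  ext i
  simp only [T.massMatrix_apply Γ hΩ]
  rw [Finset.sum_comm]
  refine Finset.sum_congr rfl fun K _ => T.sum_node_eq Γ (fun z => T.localMass K i.1 z) ?_ ?_
  · intro z hz hzS
    rw [localMass_comm]
    exact T.localMass_of_notMem (fun hK => hzS (Finset.mem_inter.2 ⟨hK, hz⟩)) _
  · exact fun z hz hzN => absurd (Finset.mem_inter.1 hz).2 hzN

/-- The weight `|K| / (d + 1)` is the integral of a barycentric coordinate, that is, a row sum of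
the element mass matrix over all vertices of `K`. -/
theorem isLumping_quadrature : T.IsLumping Γ (T.quadratureMassMatrix Γ) := by
  classical
  refine ⟨fun K => K, fun K => subset_rfl, fun K i hi => hi, ?_⟩
  ext i j
  rw [quadratureMassMatrix, of_apply, ← Finset.sum_coe_sort]
  have hphi : ∀ (K : T.cells), ∀ z ∈ (K : Finset (Pt d)), T.phi Γ i z * T.phi Γ j z =
      if z = i.1 then (if i = j then 1 else 0) else 0 := by
    intro K z hz
    have hz' := subset_convexHull ℝ _ (Finset.mem_coe.2 hz)
    rw [phi, phi, T.hat_eq_localCoord K _ hz', T.hat_eq_localCoord K _ hz',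
      T.localCoord_vertex K _ hz, T.localCoord_vertex K _ hz]
    have hij : i = j ↔ i.1 = j.1 := Subtype.ext_iff
    by_cases h : i.1 = z
    · subst h
      simp [hij, eq_comm]
    · simp [h, Ne.symm h]
  have hK : ∀ K : T.cells, vertexQuadrature (K : Finset (Pt d))
      (fun x => T.phi Γ i x * T.phi Γ j x) =
      if i = j then ∑ w ∈ (K : Finset (Pt d)), T.localMass K i.1 w else 0 := by
    intro K
    rw [vertexQuadrature, Finset.sum_congr rfl (hphi K), Finset.sum_ite_eq', T.sum_localMass]
    by_cases hi : i.1 ∈ (K : Finset (Pt d))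
    · rw [if_pos hi, T.integral_localCoord hi, ← T.volume_real_cell]
      simp [measureReal_def]
    · simp [hi, T.localCoord_of_notMem hi]
  rw [Finset.sum_congr rfl fun K _ => hK K, diagonal_apply]
  split_ifs <;> simp

variable {Γ} in
-- The product form of the bound, before Young's inequality, also shows that `M - N` annihilates
-- vectors of zero energy.
theorem IsLumping.two_mul_abs_le {N : Matrix (T.Node Γ) (T.Node Γ) ℝ} (hN : T.IsLumping Γ N)
    (hΩ : IsPolyhedralDomain Ω) (x y : T.Node Γ → ℝ) :
    2 * |x ⬝ᵥ (T.massMatrix Γ - N) *ᵥ y| ≤ T.meshSize ^ 2 *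
      ∑ K, volume.real (T.openCell K) * (‖T.cellGrad Γ K x‖ * ‖T.cellGrad Γ K y‖) := by
  obtain ⟨S, hSK, hS, rfl⟩ := hN
  set u := T.vertexValue Γ x with hu
  set v := T.vertexValue Γ y with hv
  have hzero : ∀ (K : T.cells), ∀ z ∈ T.nodes Γ, z ∉ S K → ∀ w, T.localMass K z w = 0 := by
    classical
    intro K z hz hzS w
    obtain ⟨i, -, rfl⟩ := Finset.mem_image.1 hz
    exact T.localMass_of_notMem (fun h => hzS (hS K i h)) w
  have hM : x ⬝ᵥ T.massMatrix Γ *ᵥ y =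
      ∑ K, ∑ z ∈ S K, ∑ w ∈ S K, u z * T.localMass K z w * v w := by
    simp only [dotProduct, mulVec, T.massMatrix_apply Γ hΩ, Finset.sum_mul, Finset.mul_sum]
    have h : ∀ i : T.Node Γ, ∑ j, ∑ K, x i * (T.localMass K i.1 j.1 * y j) =
        ∑ K, ∑ w ∈ S K, u i.1 * T.localMass K i.1 w * v w := by
      intro i
      rw [Finset.sum_comm]
      refine Finset.sum_congr rfl fun K _ => ?_
      rw [← T.sum_node_eq Γ (fun w => u i.1 * T.localMass K i.1 w * v w)]
      · simp only [hu, hv, vertexValue_node, mul_assoc]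
      · intro w hw hwS
        rw [localMass_comm, hzero K w hw hwS]
        simp
      · intro w _ hw
        rw [hv, T.vertexValue_of_notMem Γ y hw, mul_zero]
    rw [Finset.sum_congr rfl fun i _ => h i, Finset.sum_comm]
    refine Finset.sum_congr rfl fun K _ =>
      T.sum_node_eq Γ (fun z => ∑ w ∈ S K, u z * T.localMass K z w * v w) ?_ ?_
    · intro z hz hzS
      simp [hzero K z hz hzS]
    · intro z _ hz
      simp [hu, T.vertexValue_of_notMem Γ x hz]
  have hD : x ⬝ᵥ (Matrix.diagonal fun i => ∑ K, ∑ w ∈ S K, T.localMass K i.1 w) *ᵥ y =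
      ∑ K, ∑ z ∈ S K, u z * (∑ w ∈ S K, T.localMass K z w) * v z := by
    simp only [dotProduct, mulVec_diagonal, Finset.sum_mul, Finset.mul_sum]
    rw [Finset.sum_comm]
    refine Finset.sum_congr rfl fun K _ => ?_
    rw [← T.sum_node_eq Γ (fun z => ∑ w ∈ S K, u z * T.localMass K z w * v z)]
    · simp only [hu, hv, vertexValue_node, mul_assoc]
    · intro z hz hzS
      simp [hzero K z hz hzS]
    · intro z _ hz
      simp [hu, T.vertexValue_of_notMem Γ x hz]
  have hE : 2 * (x ⬝ᵥ (T.massMatrix Γ -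
      Matrix.diagonal fun i => ∑ K, ∑ w ∈ S K, T.localMass K i.1 w) *ᵥ y) =
      ∑ K, -∑ z ∈ S K, ∑ w ∈ S K, T.localMass K z w * ((u z - u w) * (v z - v w)) := by
    rw [sub_mulVec, dotProduct_sub, hM, hD, ← Finset.sum_sub_distrib, Finset.mul_sum]
    exact Finset.sum_congr rfl fun K _ =>
      two_mul_sum_lumping (S K) (T.localMass K) (T.localMass_comm K) u v
  rw [← abs_two, ← abs_mul, hE, Finset.mul_sum]
  refine (Finset.abs_sum_le_sum_abs _ _).trans (Finset.sum_le_sum fun K _ => ?_)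
  rw [abs_neg]
  set e := (‖T.cellGrad Γ K x‖ * T.meshSize) * (‖T.cellGrad Γ K y‖ * T.meshSize) with he
  have hmesh : 0 ≤ T.meshSize := Metric.diam_nonneg.trans (T.diam_le_meshSize K)
  have hterm : ∀ z ∈ S K, ∀ w ∈ S K, |T.localMass K z w * ((u z - u w) * (v z - v w))| ≤
      T.localMass K z w * e := by
    intro z hz w hw
    rw [abs_mul, abs_of_nonneg (T.localMass_nonneg K z w), abs_mul]
    exact mul_le_mul_of_nonneg_left (mul_le_mul
      (T.abs_vertexValue_sub_le Γ K x (hSK K hz) (hSK K hw))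
      (T.abs_vertexValue_sub_le Γ K y (hSK K hz) (hSK K hw)) (abs_nonneg _)
      (by positivity)) (T.localMass_nonneg K z w)
  -- Over all vertices the entries sum to the volume, by the partition of unity; restricting to `S
  -- K` drops nonnegative terms.
  have hvol : ∑ z ∈ S K, ∑ w ∈ S K, T.localMass K z w ≤ volume.real (T.openCell K) := by
    rw [← T.sum_integral_localCoord K]
    simp only [← T.sum_localMass]
    exact (Finset.sum_le_sum fun z _ => Finset.sum_le_sum_of_subset_of_nonneg (hSK K)
      fun w _ _ => T.localMass_nonneg K z w).trans
      (Finset.sum_le_sum_of_subset_of_nonneg (hSK K) fun z _ _ =>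
        Finset.sum_nonneg fun w _ => T.localMass_nonneg K z w)
  calc |∑ z ∈ S K, ∑ w ∈ S K, T.localMass K z w * ((u z - u w) * (v z - v w))|
      ≤ ∑ z ∈ S K, ∑ w ∈ S K, T.localMass K z w * e :=
        (Finset.abs_sum_le_sum_abs _ _).trans (Finset.sum_le_sum fun z hz =>
          (Finset.abs_sum_le_sum_abs _ _).trans (Finset.sum_le_sum fun w hw => hterm z hz w hw))
    _ = (∑ z ∈ S K, ∑ w ∈ S K, T.localMass K z w) * e := by
        simp only [Finset.sum_mul]
    _ ≤ volume.real (T.openCell K) * e := mul_le_mul_of_nonneg_right hvol (by positivity)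
    _ = _ := by rw [he]; ring

variable {Γ} in
theorem IsLumping.mulVec_injective {N : Matrix (T.Node Γ) (T.Node Γ) ℝ} (hN : T.IsLumping Γ N)
    {x : T.Node Γ → ℝ} (hx : N *ᵥ x = 0) : x = 0 := by
  obtain ⟨S, -, hS, rfl⟩ := hN
  ext i
  have hi := congrFun hx i
  rw [mulVec_diagonal] at hi
  refine (mul_eq_zero.1 hi).resolve_left (ne_of_gt ?_)
  obtain ⟨K, hK⟩ := T.exists_mem_cell i.2.1
  refine Finset.sum_pos' (fun L _ => Finset.sum_nonneg fun w _ => T.localMass_nonneg L _ w)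
    ⟨K, Finset.mem_univ K, ?_⟩
  exact Finset.sum_pos' (fun w _ => T.localMass_nonneg K _ w)
    ⟨i.1, hS K i hK, T.localMass_self_pos hK⟩

variable {Γ} in
theorem IsLumping.isLumpedPair {N : Matrix (T.Node Γ) (T.Node Γ) ℝ} (hN : T.IsLumping Γ N)
    (hΩ : IsPolyhedralDomain Ω) {a b : Pt d → Matrix (Fin d) (Fin d) ℝ} {ca cb : ℝ}
    (ha : IsDiffusionCoefficient Ω a ca) (hb : IsDiffusionCoefficient Ω b cb) :
    IsLumpedPair (T.stiffnessMatrix Γ a) (T.stiffnessMatrix Γ b) (T.massMatrix Γ) N (T.energy Γ)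
      ca cb (T.meshSize ^ 2 / 2) where
  energy_nonneg := T.energy_nonneg Γ
  isSymm_mass := T.isSymm_massMatrix Γ
  isSymm_lumped := by
    obtain ⟨S, -, -, rfl⟩ := hN
    exact isSymm_diagonal _
  coercive_left := T.stiffnessMatrix_coercive Γ hΩ ha
  coercive_right := T.stiffnessMatrix_coercive Γ hΩ hb
  mulVec_left := fun _ => T.stiffnessMatrix_mulVec_eq_zero Γ hΩ ha
  mulVec_right := fun _ => T.stiffnessMatrix_mulVec_eq_zero Γ hΩ hb
  lumping_error := fun x y => by
    refine (hN.two_mul_abs_le T hΩ x y).trans ?_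
    rw [energy, energy, ← Finset.sum_add_distrib, div_mul_eq_mul_div, mul_div_assoc,
      Finset.sum_div]
    refine mul_le_mul_of_nonneg_left (Finset.sum_le_sum fun K _ => ?_) (sq_nonneg _)
    rw [← mul_add, mul_div_assoc]
    refine mul_le_mul_of_nonneg_left ?_ measureReal_nonneg
    -- Young's inequality produces the factor `1 / 2` in `κ = h² / 2`.
    linarith [two_mul_le_add_sq ‖T.cellGrad Γ K x‖ ‖T.cellGrad Γ K y‖]
  mulVec_error := fun x hx => by
    refine dotProduct_eq_zero _ fun y => ?_
    have := hN.two_mul_abs_le T hΩ y x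
    simp only [T.cellGrad_eq_zero_of_energy Γ hx, norm_zero, mul_zero, Finset.sum_const_zero] at this
    rw [dotProduct_comm]
    exact abs_nonpos_iff.1 (by linarith)
  lumped_injective := fun _ => hN.mulVec_injective T

end Triangulation
end MixedFEM

/-! ### The main theorem. -/

open MixedFEM in
theorem mainTheorem1 (d : ℕ) (hd : 1 ≤ d) (ca cb : ℝ) (hca : 0 < ca) (hcb : 0 < cb) :
    ∃ C : ℝ, 0 < C ∧
      ∀ (Ω : Set (Pt d)), IsPolyhedralDomain Ω →
      ∀ (Γ : Set (Pt d)), Γ ⊆ frontier Ω →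
      ∀ (a b : Pt d → Matrix (Fin d) (Fin d) ℝ),
        IsDiffusionCoefficient Ω a ca → IsDiffusionCoefficient Ω b cb →
      ∀ (T : Triangulation Ω) (τ : ℝ), C * T.meshSize ^ 2 ≤ τ →
      ∀ (Mbar : Matrix (T.Node Γ) (T.Node Γ) ℝ),
        (Mbar = T.rowSumMassMatrix Γ ∨ Mbar = T.quadratureMassMatrix Γ) →
      ∀ (𝒜 ℬ : Matrix (T.Node Γ ⊕ T.Node Γ) (T.Node Γ ⊕ T.Node Γ) ℝ),
        𝒜 = blockMatrix τ (T.stiffnessMatrix Γ a) (T.stiffnessMatrix Γ b) (T.massMatrix Γ) →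
        ℬ = blockMatrix τ (T.stiffnessMatrix Γ a) (T.stiffnessMatrix Γ b) Mbar →
        IsUnit ℬ.det ∧
        (∀ μ ∈ spectrum ℂ ((ℬ⁻¹ * 𝒜).map (algebraMap ℝ ℂ)), ‖μ - 1‖ < 1) ∧
        spectralRadius ℂ ((ℬ⁻¹ * 𝒜).map (algebraMap ℝ ℂ)) < 2 := by
  have hmin : 0 < min ca cb := lt_min hca hcb
  -- This choice gives `τ c ≥ h²` for both coercivity constants `c`; as `h > 0`, this strictly
  -- exceeds the required `κ = h² / 2`.
  refine ⟨1 / min ca cb, by positivity, ?_⟩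
  rintro Ω hΩ Γ - a b ha hb T τ hτ N hN 𝒜 ℬ rfl rfl
  have hlump : T.IsLumping Γ N := by
    rcases hN with rfl | rfl
    · exact T.isLumping_rowSum Γ hΩ
    · exact T.isLumping_quadrature Γ
  have H := hlump.isLumpedPair T hΩ ha hb
  have hh : 0 < T.meshSize ^ 2 := pow_pos (T.meshSize_pos hd hΩ.isConnected.nonempty) 2
  have hτ0 : 0 < τ := lt_of_lt_of_le (by positivity) hτ
  have hle : T.meshSize ^ 2 ≤ τ * min ca cb := by
    rwa [one_div, inv_mul_le_iff₀ hmin, mul_comm] at hτ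
  have hα : T.meshSize ^ 2 / 2 < τ * ca :=
    (half_lt_self hh).trans_le (hle.trans (mul_le_mul_of_nonneg_left (min_le_left _ _) hτ0.le))
  have hβ : T.meshSize ^ 2 / 2 < τ * cb :=
    (half_lt_self hh).trans_le (hle.trans (mul_le_mul_of_nonneg_left (min_le_right _ _) hτ0.le))
  have hspec := fun μ hμ => H.norm_sub_one_lt hτ0 hα hβ (μ := μ) hμ
  exact ⟨H.isUnit_det hτ0 hα hβ, hspec, spectralRadius_lt_two_of_norm_sub_one_lt _ hspec⟩
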